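/- **Setting.** Let $G=(V,E,w)$ be a finite connected graph with edge weights at least $1$ and diameter $D$. Let $\rho>1$, $h=\lceil\log_\rho D\rceil$, and let $\mathcal P=\{P_{-1},P_0,\dots,P_h\}$ be a hierarchy in which $P_{-1}$ consists of single nodes, each $P_i$ with $0\le i\le h$ is a weak sparse partition of $G$ with parameters $(\min\{D,\rho^i\},\sigma,I)$ (each cluster has diameter at most $\sigma\min\{D,\rho^i\}$ measured in $G$, and each $\min\{D,\rho^i\}$-neighborhood meets at most $I$ clusters), and $P_h$ is the single cluster $V$. Each cluster $X$ has a leader $l(X)\in X$ and a tree $T(X)$ containing $X$, initially a shortest path tree of $G$ rooted at $l(X)$; $l(V)=r$ is the root. **Failures.** Then $f\ge1$ edges fail one after the other, without disconnecting the graph. After the failure of an edge $e$, every cluster $X$ below the top level with $e\in T(X)$ is split along the two components of $T(X)\setminus\{e\}$; the part that contains $l(X)$ keeps this leader, and the other part, if it is nonempty, gets as leader a node of $X$ in it that is closest on the tree to the endpoint of $e$ in that component. Fix a constant $\kappa\ge1$. If all nodes are within distance $\kappa\sigma\rho^h$ of $r$, the current top level $h$ may be kept; otherwise (and, optionally, as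 soon as some node is at distance at least $\sigma\rho^h$) the top level becomes the least $h'$ such that all nodes are at distance less than $\sigma\rho^{h'}$ from $r$, and levels $h,\dots,h'-1$ all consist of the pieces of the old root cluster, split in the same way. The top level is always the single cluster $V$ with an updated shortest path tree of $r$. Let $G'$ be the final graph, $d$ its distance, $D'$ its diameter, $h'$ the final top level, $r_i=\min\{D',\rho^i\}$, and let $l_i(u)$ be the leader of the cluster containing $u$ at level $i$ after all repairs ($l_{-1}(u)=u$). **Directory.** The directory path is $\varphi_{h'},\dots,\varphi_0,\varphi_{-1}$, where $\varphi_{-1}$ is the owner of the token and $\varphi_i=l_i(w_i)$ for the node $w_i$ that added the path node at level $i$; at the beginning the owner and the $w_i$ are arbitrary. A move issued by $u$ queries, at levels $i=0,1,\dots$, the leaders of all clusters that meet the $r_i$-neighborhood of $u$, up to the first level $j$ at which one of them is $\varphi_i$. At each level $0\le i<j$ it informs $l_i(u)$, which becomes the new path node ($w_i:=u$), is linked to $l_{i-1}(u)$, and informs the special parent $l_{\min\{i+k,h'\}}(u)$; also $\varphi_j$ is linked to $l_{j-1}(u)$. Here $k$ is a fixed nonnegative integer with $\rho^k\le c'\sigma$,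 for a constant $c'$. Then the move follows the old path from $\varphi_j$ down to the old owner, the old path nodes at levels $0,\dots,j-1$ delete their special parent entries, and the token is sent to $u$, the new owner. Each message between $a$ and $b$ costs $d(a,b)$; queries (with their answers) and bidirectional links count twice. **Theorem.** For all constants $c'$ and $\kappa\ge 1$ there is a constant $C>0$, depending only on $c'$ and $\kappa$, such that the following holds in every such setting. Let $S$ be a sequence of move requests issued by nodes $v_1,\dots,v_q$ with $v_{j+1}\ne v_j$ for $1\le j<q$, all issued after the $f$ failures have been repaired and executed sequentially. If $q>\max\{h',1\}^2D'$, then the total cost of the moves in $S$ is at most $$C\,\max\{h',1\}\,\sigma\,\rho\,(fI+\sigma)\cdot\sum_{j=1}^{q-1}d(v_j,v_{j+1}),$$ that is, within a factor $\mathcal O(h'\sigma\rho(fI+\sigma))$ of the optimal cost $\sum_{j=1}^{q-1}d(v_j,v_{j+1})$. -/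

import Mathlib

/-! Weighted graphs: distance, diameter, shortest path trees. -/

section WeightedGraph

variable {V : Type*}

/-- Length of a shortest path from `u` to `v` in `G` with edge weights `w`. -/
noncomputable def wdist (G : SimpleGraph V) (w : Sym2 V → ℝ) (u v : V) : ℝ :=
  ⨅ p : G.Walk u v, (p.edges.map w).sum

/-- The diameter of the weighted graph `G`. -/
noncomputable def wdiam (G : SimpleGraph V) (w : Sym2 V → ℝ) : ℝ :=
  ⨆ p : V × V, wdist G w p.1 p.2

/-- `T` is a shortest path tree of `G` rooted at `r`. It need not reach all of `V`; the nodes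
lying on it are those reachable from `r` in `T`. -/
structure IsShortestPathTree (G : SimpleGraph V) (w : Sym2 V → ℝ) (T : SimpleGraph V) (r : V) :
    Prop where
  le : T ≤ G
  acyclic : T.IsAcyclic
  edges_reachable : ∀ a b, T.Adj a b → T.Reachable r a
  dist_eq : ∀ x, T.Reachable r x → wdist T w r x = wdist G w r x

/-- The part of the forest `T` that is connected to the node `a`. -/
def treePart (T : SimpleGraph V) (a : V) : SimpleGraph V where
  Adj x y := T.Adj x y ∧ T.Reachable a x
  symm := ⟨fun _ _ h => ⟨h.1.symm, h.2.trans h.1.reachable⟩⟩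
  loopless := ⟨fun x h => T.loopless.irrefl x h.1⟩

end WeightedGraph

/-! Clusters, hierarchies, and their repair after an edge failure. -/

section Hierarchy

variable {V : Type*}

/-- A cluster `X` with its leader `l(X)` and its stored spanning tree `T(X)`. The tree connects
all nodes of `X`, and may also run through nodes outside of `X`. -/
structure Cluster (V : Type*) where
  nodes : Set V
  leader : V
  tree : SimpleGraph V

/-- A partition hierarchy. `cluster i u` is the cluster that contains `u` at level `i`, for
`0 ≤ i ≤ top`. The clusters of level `-1` are the single nodes and are not stored. -/
structure Hierarchy (V : Type*) where
  top : ℕ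
  root : V
  cluster : ℕ → V → Cluster V

/-- `P` assigns to each node the cluster containing it in a `(r, σ, I)`-weak sparse partition
of `G`, every cluster having a leader in it and a shortest path tree of the leader. -/
structure IsWeakSparsePartition (G : SimpleGraph V) (w : Sym2 V → ℝ) (r σ : ℝ) (I : ℕ)
    (P : V → Cluster V) : Prop where
  mem : ∀ u, u ∈ (P u).nodes
  eq_of_mem : ∀ u, ∀ x ∈ (P u).nodes, P x = P u
  weak_diam : ∀ u, ∀ x ∈ (P u).nodes, ∀ y ∈ (P u).nodes, wdist G w x y ≤ r * σ
  sparse : ∀ u, (P '' {x | wdist G w u x ≤ r}).ncard ≤ I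
  leader_mem : ∀ u, (P u).leader ∈ (P u).nodes
  tree_spt : ∀ u, IsShortestPathTree G w (P u).tree (P u).leader
  tree_spans : ∀ u, ∀ x ∈ (P u).nodes, (P u).tree.Reachable (P u).leader x

/-- `ℋ` is a hierarchy of `(σ, I)`-weak sparse partitions of `G` with locality parameter `ρ`:
it has top level `h = ⌈log_ρ D⌉`, level `i` is a `(min {D, ρ ^ i}, σ, I)`-weak sparse partition,
and level `h` is a single cluster led by the root. -/
structure IsWeakSparseHierarchy (G : SimpleGraph V) (w : Sym2 V → ℝ) (ρ σ : ℝ) (I : ℕ)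
    (ℋ : Hierarchy V) : Prop where
  top_eq : ℋ.top = ⌈Real.logb ρ (wdiam G w)⌉₊
  level : ∀ i ≤ ℋ.top,
    IsWeakSparsePartition G w (min (wdiam G w) (ρ ^ i)) σ I (ℋ.cluster i)
  top_nodes : ∀ u, (ℋ.cluster ℋ.top u).nodes = Set.univ
  top_leader : ∀ u, (ℋ.cluster ℋ.top u).leader = ℋ.root

/-- Reclustering of a cluster `X` after the failure of the edge `e`: `X.Reclustered w e u Y` says
that `Y` is the new cluster of the node `u` of `X`. If `e` lies on `T(X)`, then `X` is split along
the two components of `T(X) \ {e}`. The component of `l(X)` keeps its leader. In the other one,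
which contains the endpoint `v` of `e`, the new leader is a node `l` of `X` closest to `v` on the
tree. -/
inductive Cluster.Reclustered (w : Sym2 V → ℝ) (e : Sym2 V) (X : Cluster V) (u : V) :
    Cluster V → Prop
  | intact : e ∉ X.tree.edgeSet → Cluster.Reclustered w e X u X
  | kept : e ∈ X.tree.edgeSet →
      (X.tree.deleteEdges {e}).Reachable X.leader u →
      Cluster.Reclustered w e X u
        { nodes := {x | x ∈ X.nodes ∧ (X.tree.deleteEdges {e}).Reachable X.leader x}
          leader := X.leader
          tree := treePart (X.tree.deleteEdges {e}) X.leader }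
  | cut (v l : V) : e ∈ X.tree.edgeSet → v ∈ e →
      ¬ (X.tree.deleteEdges {e}).Reachable X.leader v →
      (X.tree.deleteEdges {e}).Reachable v u →
      l ∈ X.nodes → (X.tree.deleteEdges {e}).Reachable v l →
      (∀ y ∈ X.nodes, (X.tree.deleteEdges {e}).Reachable v y →
        wdist (X.tree.deleteEdges {e}) w v l ≤ wdist (X.tree.deleteEdges {e}) w v y) →
      Cluster.Reclustered w e X u
        { nodes := {x | x ∈ X.nodes ∧ (X.tree.deleteEdges {e}).Reachable v x}
          leader := l
          tree := treePart (X.tree.deleteEdges {e}) v }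

/-- The partition `P'` results from `P` by reclustering every cluster after the failure of `e`. -/
def LevelReclustered (w : Sym2 V → ℝ) (e : Sym2 V) (P P' : V → Cluster V) : Prop :=
  (∀ u, (P u).Reclustered w e u (P' u)) ∧ ∀ u, ∀ x ∈ (P' u).nodes, P' x = P' u

/-- `P` is the single cluster `V`, led by `r`, with a shortest path tree of `r` in `G`. -/
def IsRootLevel (G : SimpleGraph V) (w : Sym2 V → ℝ) (r : V) (P : V → Cluster V) : Prop :=
  ∃ T, IsShortestPathTree G w T r ∧ (∀ x, T.Reachable r x) ∧
    ∀ u, P u = { nodes := Set.univ, leader := r, tree := T }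

/-- Repair of the hierarchy `ℋ` after the failure of an edge `e`, where `G` is the graph that
remains. All levels below the root level are reclustered. The number of layers may be left as it
is only while all nodes are within distance `κ σ ρ ^ h` of the root `r`, `h` being the current
top level (`keep`). Otherwise (`grow`) the new top level is the smallest `h'` such that all nodes
are at distance less than `σ ρ ^ h'` from `r`; the old root cluster is split as any other one, and
its pieces form the levels `h, …, h' - 1`. The top level always is the whole of `V`, with the
updated shortest path tree of `r`. -/
inductive Repaired (w : Sym2 V → ℝ) (ρ σ κ : ℝ) (G : SimpleGraph V) (e : Sym2 V)
    (ℋ ℋ' : Hierarchy V) : Prop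
  | keep : ℋ'.root = ℋ.root → ℋ'.top = ℋ.top →
      (∀ x, wdist G w ℋ.root x ≤ κ * σ * ρ ^ ℋ.top) →
      (∀ i < ℋ.top, LevelReclustered w e (ℋ.cluster i) (ℋ'.cluster i)) →
      IsRootLevel G w ℋ.root (ℋ'.cluster ℋ.top) →
      Repaired w ρ σ κ G e ℋ ℋ'
  | grow : ℋ'.root = ℋ.root → ℋ.top < ℋ'.top →
      IsLeast {m : ℕ | ∀ x, wdist G w ℋ.root x < σ * ρ ^ m} ℋ'.top →
      (∀ i < ℋ.top, LevelReclustered w e (ℋ.cluster i) (ℋ'.cluster i)) →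
      LevelReclustered w e (ℋ.cluster ℋ.top) (ℋ'.cluster ℋ.top) →
      (∀ i, ℋ.top < i → i < ℋ'.top → ℋ'.cluster i = ℋ'.cluster ℋ.top) →
      IsRootLevel G w ℋ.root (ℋ'.cluster ℋ'.top) →
      Repaired w ρ σ κ G e ℋ ℋ'

/-- `AfterFailures w ρ σ κ G ℋ f G' ℋ'`: starting from the graph `G` with hierarchy `ℋ`, after
`f` edge failures, none of which disconnects the graph, the graph is `G'` and the repaired
hierarchy is `ℋ'`. -/
inductive AfterFailures (w : Sym2 V → ℝ) (ρ σ κ : ℝ) (G : SimpleGraph V) (ℋ : Hierarchy V) :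
    ℕ → SimpleGraph V → Hierarchy V → Prop
  | zero : AfterFailures w ρ σ κ G ℋ 0 G ℋ
  | succ (f : ℕ) (G' : SimpleGraph V) (ℋ' ℋ'' : Hierarchy V) (e : Sym2 V) :
      AfterFailures w ρ σ κ G ℋ f G' ℋ' → e ∈ G'.edgeSet → (G'.deleteEdges {e}).Connected →
      Repaired w ρ σ κ (G'.deleteEdges {e}) e ℋ' ℋ'' →
      AfterFailures w ρ σ κ G ℋ (f + 1) (G'.deleteEdges {e}) ℋ''

end Hierarchy

/-! The directory and its move operation. -/

/-- The network on which move operations are executed: the current graph with its hierarchy, the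
locality parameter, and the number `k` of levels between a node on the directory path and its
special parent. -/
structure Network (V : Type*) where
  graph : SimpleGraph V
  weight : Sym2 V → ℝ
  hierarchy : Hierarchy V
  ρ : ℝ
  k : ℕ

/-- A state of the directory: the owner of the token, and for each level `i ≥ 0` the node that
added the current node of the directory path at level `i`. When clusters split, the path is updated
to go through the leaders of the clusters that contain these nodes, so that the path is determined
by this data and the current hierarchy (see `Network.path`). A publish operation by `u`, earlier
moves (also concurrent ones), and additional layers lead to various values of `adder`; all of them
are allowed. -/
structure Directory (V : Type*) where
  owner : V
  adder : ℕ → V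

/-- For a sequence of nodes at levels `0, 1, …` on top of a node `a` at level `-1`, the node one
level below level `i`. -/
def levelBelow {V : Type*} (a : V) (g : ℕ → V) : ℕ → V
  | 0 => a
  | i + 1 => g i

namespace Network

variable {V : Type*} (N : Network V)

/-- The distance in the current graph, that is the cost of sending one message. -/
noncomputable def dist (u v : V) : ℝ := wdist N.graph N.weight u v

/-- The diameter of the current graph. -/
noncomputable def diam : ℝ := wdiam N.graph N.weight

/-- `r_i = min {D, ρ ^ i}`, for the current diameter `D`. -/
noncomputable def r (i : ℕ) : ℝ := min N.diam (N.ρ ^ i)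

/-- `l_i(u)`: the leader of the cluster of `u` at level `i`. -/
def lead (i : ℕ) (u : V) : V := (N.hierarchy.cluster i u).leader

/-- The special parent of `u` with respect to level `i`: the leader of `u` at level `i + k`, or the
root if there is no such level. -/
def specialParent (i : ℕ) (u : V) : V := N.lead (min (i + N.k) N.hierarchy.top) u

/-- The node `φ_i` of the directory path at level `i ≥ 0`: the leader of the (current) cluster that
contains the node that added it. -/
def path (δ : Directory V) (i : ℕ) : V := N.lead i (δ.adder i)

/-- The leaders that `u` contacts at level `i`: those of the clusters that intersect the
`r_i`-neighborhood of `u`. -/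
def contacts (i : ℕ) (u : V) : Set V := N.lead i '' {x | N.dist u x ≤ N.r i}

/-- The lowest level at which a move operation of `u` discovers the directory path. -/
noncomputable def meet (δ : Directory V) (u : V) : ℕ :=
  sInf {i : ℕ | N.path δ i ∈ N.contacts i u}

/-- The directory after a move operation issued by `u`: below the level at which `u` has discovered
the directory path, the path now consists of the leaders of `u`. -/
noncomputable def move (δ : Directory V) (u : V) : Directory V where
  owner := u
  adder i := if i < N.meet δ u then u else δ.adder i

open Classical in
/-- Message cost of the upward phase of a move of `u` that discovers the path at level `j`:
* query all nearby leaders at levels `0, …, j` and wait for their answers;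
* at each level `i < j`, tell the leader of `u` that it joins the directory path, set up links in
  both directions between it and the new path node one level below, and let it inform the special
  parent;
* set up links in both directions between `φ_j` and the new path node at level `j - 1`. -/
noncomputable def upCost [Fintype V] (δ : Directory V) (u : V) : ℝ :=
  (∑ i ∈ Finset.range (N.meet δ u + 1),
    ∑ l ∈ Finset.univ.filter (fun l => l ∈ N.contacts i u), 2 * N.dist u l)
  + (∑ i ∈ Finset.range (N.meet δ u),
      (N.dist u (N.lead i u)
        + 2 * N.dist (N.lead i u) (levelBelow u (fun m => N.lead m u) i)
        + N.dist (N.lead i u) (N.specialParent i u)))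
  + 2 * N.dist (N.path δ (N.meet δ u)) (levelBelow u (fun m => N.lead m u) (N.meet δ u))

/-- Message cost of the downward phase of a move of `u` that discovers the path at level `j`: follow
the old directory path from `φ_j` to the old owner, let each removed path node (levels
`0, …, j - 1`) delete its entry at its special parent, and send the token to `u`. -/
noncomputable def downCost (δ : Directory V) (u : V) : ℝ :=
  (∑ i ∈ Finset.range (N.meet δ u + 1),
    N.dist (N.path δ i) (levelBelow δ.owner (N.path δ) i))
  + (∑ i ∈ Finset.range (N.meet δ u),
      N.dist (N.path δ i) (N.specialParent i (δ.adder i)))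
  + N.dist δ.owner u

/-- Total cost of the move operations issued by the nodes of a list, executed one after the other
from the directory state `δ`. -/
noncomputable def totalCost [Fintype V] : Directory V → List V → ℝ
  | _, [] => 0
  | δ, u :: S => N.upCost δ u + N.downCost δ u + totalCost (N.move δ u) S

/-- Optimal cost of serving move requests from `v_1, …, v_q` in this order: the sum of the
distances between `v_i` and `v_{i+1}`, for `1 ≤ i < q`. -/
noncomputable def optCost (S : List V) : ℝ := (List.zipWith N.dist S S.tail).sum

end Network

/-!
The cost of a move that discovers the directory path at level `j` is at most a constant times
`σ (f I + σ) ∑_{i ≤ j} r_i`, and a potential argument compares the radii `r_i` with the distances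
between the requests.

*Failures.* The repairs never look at anything but the original trees: after the edges `F` have
failed, the clusters into which a cluster `X` has been split are the components of `T(X) \ F`
(`IsSplitOf`), whatever leaders have been chosen. Two nodes in such a component are still joined by
the path of `T(X)` between them, so their distance is at most twice the original radius
(`IsDegraded.wdist_leader_le`), independently of the number of failures. Each component contains
`l(X)` or an endpoint of a failed edge, so `X` has at most `2 f + 1` pieces and a neighborhood that
met `I` clusters meets at most `(2 f + 1) I` of their pieces (`IsDegraded.ncard_image_le`). Pieces
of an old root cluster obey the same bounds, as the root cluster had radius at most `κ σ ρ ^ h`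
and was the only one on its level (`AfterFailures.isDegradedHierarchy`).

*One move.* The bounds on distances to leaders and on the number of contacts, together with
`r_{i+k} ≤ ρ ^ k r_i ≤ c' σ r_i` for the special parents, bound the cost of a move, except that
links of the given initial path may be arbitrarily long. Such a link is paid for at most once,
since a move that uses a link replaces it (`Network.linkPotential`).

*Sequences of moves.* If a move of `u` does not discover the path at level `i`, then `u` is at
distance more than `r_i` from the node `w_i` that added the path node there, and `u` takes the place
of `w_i`. Hence the distance from the owner to `w_i` is a potential that drops to zero in such a
move and grows in any move by at most the distance travelled
(`Network.IsLocal.sum_r_add_adderPotential_le`). So each level contributes to `∑ r_i` at most the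
distance travelled plus the initial potential, and passing from `r_i` to `r_{i+1}` costs a factor
`ρ`. Level `0` has `r_0 ≤ 1` and is paid for by the number of requests, which is at most
`opt + 1` because different nodes are at distance at least `1`. The initial potentials are at most
`O(h' D')`, and `D' < q ≤ 2 opt`.
-/

/-! ### Distances in weighted graphs -/

section WeightedDistance

variable {V : Type*} {G H T : SimpleGraph V} {w : Sym2 V → ℝ}

lemma walk_weight_nonneg (hw : ∀ e ∈ G.edgeSet, 1 ≤ w e) {u v : V} (p : G.Walk u v) :
    0 ≤ (p.edges.map w).sum := by
  refine List.sum_nonneg fun x hx => ?_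
  obtain ⟨e, he, rfl⟩ := List.mem_map.1 hx
  exact zero_le_one.trans (hw e (p.edges_subset_edgeSet he))

lemma wdist_le_walk (hw : ∀ e ∈ G.edgeSet, 1 ≤ w e) {u v : V} (p : G.Walk u v) :
    wdist G w u v ≤ (p.edges.map w).sum :=
  ciInf_le ⟨0, by rintro _ ⟨q, rfl⟩; exact walk_weight_nonneg hw q⟩ p

lemma le_wdist {u v : V} {c : ℝ} (h : G.Reachable u v)
    (hc : ∀ p : G.Walk u v, c ≤ (p.edges.map w).sum) : c ≤ wdist G w u v :=
  have := h.elim (fun p => (⟨p⟩ : Nonempty (G.Walk u v)))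
  le_ciInf hc

lemma wdist_nonneg (hw : ∀ e ∈ G.edgeSet, 1 ≤ w e) (u v : V) : 0 ≤ wdist G w u v :=
  Real.iInf_nonneg fun p => walk_weight_nonneg hw p

lemma wdist_self (hw : ∀ e ∈ G.edgeSet, 1 ≤ w e) (u : V) : wdist G w u u = 0 :=
  le_antisymm ((wdist_le_walk hw .nil).trans (by simp)) (wdist_nonneg hw u u)

lemma wdist_comm (u v : V) : wdist G w u v = wdist G w v u := by
  refine Function.Surjective.iInf_congr (fun p : G.Walk u v => p.reverse)
    (fun q => ⟨q.reverse, by simp⟩) fun p => ?_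
  simp [SimpleGraph.Walk.edges_reverse, List.sum_reverse]

lemma wdist_triangle (hw : ∀ e ∈ G.edgeSet, 1 ≤ w e) {u v x : V} (huv : G.Reachable u v)
    (hvx : G.Reachable v x) : wdist G w u x ≤ wdist G w u v + wdist G w v x := by
  rw [← sub_le_iff_le_add]
  refine le_wdist huv fun p => ?_
  rw [sub_le_comm]
  refine le_wdist hvx fun q => ?_
  have := wdist_le_walk hw (p.append q)
  simp only [SimpleGraph.Walk.edges_append, List.map_append, List.sum_append] at this
  linarith

lemma one_le_wdist (hw : ∀ e ∈ G.edgeSet, 1 ≤ w e) {u v : V} (h : G.Reachable u v)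
    (hne : u ≠ v) : 1 ≤ wdist G w u v := by
  refine le_wdist h fun p => ?_
  cases p with
  | nil => exact absurd rfl hne
  | cons hadj p =>
    have h1 := hw _ (SimpleGraph.mem_edgeSet _ |>.2 hadj)
    have h2 := walk_weight_nonneg hw p
    simp only [SimpleGraph.Walk.edges_cons, List.map_cons, List.sum_cons]
    linarith

lemma wdist_anti (hw : ∀ e ∈ G.edgeSet, 1 ≤ w e) (hle : H ≤ G) {u v : V}
    (h : H.Reachable u v) : wdist G w u v ≤ wdist H w u v := by
  refine le_wdist h fun p => ?_
  simpa [SimpleGraph.Walk.edges_mapLe_eq_edges] using wdist_le_walk hw (p.mapLe hle)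

lemma wdist_le_wdiam [Finite V] (u v : V) : wdist G w u v ≤ wdiam G w :=
  le_ciSup (f := fun p : V × V => wdist G w p.1 p.2) (Set.finite_range _).bddAbove (u, v)

/-- In a forest the only path between two nodes is a shortest one, so deleting edges does not
change the distance of nodes that stay connected. -/
lemma wdist_le_of_isAcyclic (hw : ∀ e ∈ T.edgeSet, 1 ≤ w e) (hT : T.IsAcyclic) (hle : H ≤ T)
    {u v : V} (h : H.Reachable u v) : wdist H w u v ≤ wdist T w u v := by
  classical
  obtain ⟨p, hp⟩ := h.exists_isPath
  refine le_wdist (h.mono hle) fun q => ?_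
  have hH : ∀ e ∈ H.edgeSet, 1 ≤ w e := fun e he =>
    hw e (SimpleGraph.edgeSet_subset_edgeSet.2 hle he)
  refine (wdist_le_walk hH p).trans ?_
  have heq : p.mapLe hle = q.bypass :=
    congrArg Subtype.val ((hT.subsingleton_path u v).elim ⟨p.mapLe hle, hp.mapLe hle⟩
      ⟨q.bypass, q.bypass_isPath⟩)
  have hsub : p.edges ⊆ q.edges := by
    rw [← SimpleGraph.Walk.edges_mapLe_eq_edges hle p, heq]
    exact q.edges_bypass_subset_edges
  obtain ⟨l, hl, hlq⟩ := List.subperm_of_subset hp.isTrail.edges_nodup hsub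
  rw [← (hl.map w).sum_eq]
  refine List.Sublist.sum_le_sum (hlq.map w) fun x hx => ?_
  obtain ⟨e, he, rfl⟩ := List.mem_map.1 hx
  exact zero_le_one.trans (hw e (q.edges_subset_edgeSet he))

end WeightedDistance

/-! ### Components of a forest after edge deletions -/

section TreePart

variable {V : Type*} {H T : SimpleGraph V} {s : Set (Sym2 V)}

lemma treePart_deleteEdges_reachable_iff {a y z : V} (hy : H.Reachable a y) :
    ((treePart H a).deleteEdges s).Reachable y z ↔ (H.deleteEdges s).Reachable y z := by
  constructor
  · exact fun h => h.mono (SimpleGraph.deleteEdges_mono fun _ _ hadj => And.left hadj)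
  · rintro ⟨p⟩
    induction p with
    | nil => rfl
    | cons h p ih =>
      obtain ⟨hadj, hs⟩ := SimpleGraph.deleteEdges_adj.1 h
      refine .trans (SimpleGraph.Adj.reachable ?_) (ih (hy.trans hadj.reachable))
      exact SimpleGraph.deleteEdges_adj.2 ⟨⟨hadj, hy⟩, hs⟩

lemma treePart_reachable_iff {a y z : V} (hy : H.Reachable a y) :
    (treePart H a).Reachable y z ↔ H.Reachable y z := by
  simpa using treePart_deleteEdges_reachable_iff (s := ∅) (z := z) hy

lemma treePart_eq_of_reachable {a b : V} (h : H.Reachable a b) : treePart H a = treePart H b := by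
  ext x y
  exact and_congr_right fun _ => ⟨h.symm.trans, h.trans⟩

lemma treePart_deleteEdges_treePart {a v : V} (hv : H.Reachable a v) :
    treePart ((treePart H a).deleteEdges s) v = treePart (H.deleteEdges s) v := by
  ext x y
  simp only [treePart, SimpleGraph.deleteEdges_adj]
  constructor
  · rintro ⟨⟨⟨h, -⟩, hs⟩, hr⟩
    exact ⟨⟨h, hs⟩, (treePart_deleteEdges_reachable_iff hv).1 hr⟩
  · rintro ⟨⟨h, hs⟩, hr⟩
    exact ⟨⟨⟨h, hv.trans (hr.mono (SimpleGraph.deleteEdges_le s))⟩, hs⟩,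
      (treePart_deleteEdges_reachable_iff hv).2 hr⟩

/-- Cut the walk from `l` to `x` behind its last deleted edge: the rest starts at `l` or at an
endpoint of a deleted edge. Hence `n` deletions leave at most `2 * n + 1` components. -/
lemma exists_reachable_deleteEdges {l x : V} (h : T.Reachable l x) :
    ∃ a, (a = l ∨ ∃ e ∈ s, a ∈ e) ∧ (T.deleteEdges s).Reachable a x := by
  obtain ⟨p⟩ := h
  induction p with
  | nil => exact ⟨_, .inl rfl, .rfl⟩
  | @cons l y x hadj p ih =>
    obtain ⟨a, rfl | ha, hr⟩ := ih
    · by_cases hs : s(l, a) ∈ s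
      · exact ⟨a, .inr ⟨_, hs, Sym2.mem_mk_right _ _⟩, hr⟩
      · exact ⟨l, .inl rfl, .trans (SimpleGraph.Adj.reachable
          (SimpleGraph.deleteEdges_adj.2 ⟨hadj, hs⟩)) hr⟩
    · exact ⟨a, .inr ha, hr⟩

end TreePart

/-! ### Repaired partitions -/

section Degraded

variable {V : Type*}

/-- `P` is the partition into clusters that is obtained from the partition `B` by splitting each
cluster along the components of its tree that are left after the deletion of the edges in `F`. The
choice of the leaders is left open. -/
structure IsSplitOf (B P : V → Cluster V) (F : Set (Sym2 V)) : Prop where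
  mem_iff : ∀ u x, x ∈ (P u).nodes ↔
    x ∈ (B u).nodes ∧ ((B u).tree.deleteEdges F).Reachable u x
  tree_eq : ∀ u, (P u).tree = treePart ((B u).tree.deleteEdges F) u
  leader_mem : ∀ u, (P u).leader ∈ (P u).nodes
  eq_of_mem : ∀ u, ∀ x ∈ (P u).nodes, P x = P u

lemma IsSplitOf.reclustered {w : Sym2 V → ℝ} {e : Sym2 V} {B P P' : V → Cluster V}
    {F : Set (Sym2 V)} (h : IsSplitOf B P F) (h' : LevelReclustered w e P P') :
    IsSplitOf B P' (F ∪ {e}) := by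
  have key : ∀ u, (∀ x, x ∈ (P' u).nodes ↔
      x ∈ (B u).nodes ∧ ((B u).tree.deleteEdges (F ∪ {e})).Reachable u x) ∧
      (P' u).tree = treePart ((B u).tree.deleteEdges (F ∪ {e})) u ∧
      (P' u).leader ∈ (P' u).nodes := by
    intro u
    rw [← SimpleGraph.deleteEdges_deleteEdges]
    have hmem := h.mem_iff u
    have htree := h.tree_eq u
    have hlead := h.leader_mem u
    have hrec := h'.1 u
    generalize P' u = X' at hrec ⊢
    generalize P u = X at *
    generalize hH : (B u).tree.deleteEdges F = H at *
    have hl := ((hmem _).1 hlead).2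
    have hdel : (H.deleteEdges {e}) ≤ H := SimpleGraph.deleteEdges_le _
    cases hrec with
    | intact he =>
      rw [htree] at he
      have hself : (treePart H u).deleteEdges {e} = treePart H u := by simpa using he
      refine ⟨fun x => ?_, ?_, hlead⟩
      · rw [hmem, ← treePart_reachable_iff (.refl u),
          ← treePart_deleteEdges_reachable_iff (s := {e}) (.refl u), hself]
      · rw [htree, ← treePart_deleteEdges_treePart (s := {e}) (.refl u), hself]
        simpa using (treePart_deleteEdges_treePart (s := ∅) (H := H) (.refl u)).symm
    | kept he hu =>
      rw [htree, treePart_deleteEdges_reachable_iff hl] at hu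
      refine ⟨fun x => ?_, ?_, ⟨hlead, .rfl⟩⟩
      · rw [Set.mem_ofPred_eq, htree, treePart_deleteEdges_reachable_iff hl, hmem]
        exact ⟨fun ⟨h1, h2⟩ => ⟨h1.1, hu.symm.trans h2⟩,
          fun ⟨h1, h2⟩ => ⟨⟨h1, h2.mono hdel⟩, hu.trans h2⟩⟩
      · simp only
        rw [htree, treePart_deleteEdges_treePart hl, treePart_eq_of_reachable hu]
    | cut v l he hv hnv hu hlX hvl hmin =>
      have huv : H.Reachable u v := by
        rw [htree] at he
        obtain ⟨b, rfl⟩ := hv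
        exact (SimpleGraph.mem_edgeSet _ |>.1 he).2
      rw [htree, treePart_deleteEdges_reachable_iff huv] at hu hvl
      refine ⟨fun x => ?_, ?_, ⟨hlX, ?_⟩⟩
      · rw [Set.mem_ofPred_eq, htree, treePart_deleteEdges_reachable_iff huv, hmem]
        exact ⟨fun ⟨h1, h2⟩ => ⟨h1.1, hu.symm.trans h2⟩,
          fun ⟨h1, h2⟩ => ⟨⟨h1, h2.mono hdel⟩, hu.trans h2⟩⟩
      · simp only
        rw [htree, treePart_deleteEdges_treePart huv, treePart_eq_of_reachable hu]
      · rw [htree, treePart_deleteEdges_reachable_iff huv]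
        exact hvl
  exact ⟨fun u => (key u).1, fun u => (key u).2.1, fun u => (key u).2.2, h'.2⟩

/-- `B` is a partition into clusters from which the partition `P` of the current graph `G'` has
developed by the failure of the at most `n` edges of `F`. Trees have radius at most `R` within
their clusters, and in the original graph `G` each ball of radius `s` meets at most `I` clusters
of `B`. -/
structure IsDegradedFrom (G G' : SimpleGraph V) (w : Sym2 V → ℝ) (R s : ℝ) (I n : ℕ)
    (B P : V → Cluster V) (F : Set (Sym2 V)) : Prop where
  split : IsSplitOf B P F
  card_le : F.ncard ≤ n
  mem : ∀ u, u ∈ (B u).nodes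
  tree_le : ∀ u, (B u).tree ≤ G
  acyclic : ∀ u, (B u).tree.IsAcyclic
  delete_le : ∀ u, (B u).tree.deleteEdges F ≤ G'
  reachable : ∀ u, ∀ x ∈ (B u).nodes, (B u).tree.Reachable (B u).leader x
  radius : ∀ u, ∀ x ∈ (B u).nodes, wdist (B u).tree w (B u).leader x ≤ R
  sparse : ∀ u, (B '' {x | wdist G w u x ≤ s}).ncard ≤ I

/-- `P` has developed by at most `n` edge failures from some partition as in
`IsDegradedFrom`. -/
def IsDegraded (G G' : SimpleGraph V) (w : Sym2 V → ℝ) (R s : ℝ) (I n : ℕ)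
    (P : V → Cluster V) : Prop :=
  ∃ B F, IsDegradedFrom G G' w R s I n B P F

variable {G G' : SimpleGraph V} {w : Sym2 V → ℝ} {R s : ℝ} {I n : ℕ} {P : V → Cluster V}

lemma IsDegraded.mono {R' : ℝ} (h : IsDegraded G G' w R s I n P) (hR : R ≤ R') :
    IsDegraded G G' w R' s I n P := by
  obtain ⟨B, F, h⟩ := h
  exact ⟨B, F, { h with radius := fun u x hx => (h.radius u x hx).trans hR }⟩

lemma IsDegraded.reclustered {e : Sym2 V} {P' : V → Cluster V}
    (h : IsDegraded G G' w R s I n P) (h' : LevelReclustered w e P P') :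
    IsDegraded G (G'.deleteEdges {e}) w R s I (n + 1) P' := by
  obtain ⟨B, F, h⟩ := h
  refine ⟨B, F ∪ {e}, { h with
    split := h.split.reclustered h'
    card_le := ?_
    delete_le := fun u => ?_ }⟩
  · exact (Set.ncard_union_le F {e}).trans (by simpa using h.card_le)
  · rw [← SimpleGraph.deleteEdges_deleteEdges]
    exact SimpleGraph.deleteEdges_mono (h.delete_le u)

/-- Two nodes of one cluster are joined in the current graph by a path of the original tree. Its
length is at most twice the radius, no matter how often the leader has changed. -/
lemma IsDegraded.wdist_leader_le (hw : ∀ e ∈ G.edgeSet, 1 ≤ w e) (hle : G' ≤ G)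
    (h : IsDegraded G G' w R s I n P) (u : V) : wdist G' w u (P u).leader ≤ 2 * R := by
  obtain ⟨B, F, h⟩ := h
  obtain ⟨hl, hreach⟩ := (h.split.mem_iff u _).1 (h.split.leader_mem u)
  have hwT : ∀ e ∈ (B u).tree.edgeSet, 1 ≤ w e := fun e he =>
    hw e (SimpleGraph.edgeSet_subset_edgeSet.2 (h.tree_le u) he)
  have hwG : ∀ e ∈ G'.edgeSet, 1 ≤ w e := fun e he =>
    hw e (SimpleGraph.edgeSet_subset_edgeSet.2 hle he)
  calc wdist G' w u (P u).leader
      ≤ wdist ((B u).tree.deleteEdges F) w u (P u).leader := wdist_anti hwG (h.delete_le u) hreach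
    _ ≤ wdist (B u).tree w u (P u).leader :=
        wdist_le_of_isAcyclic hwT (h.acyclic u) (SimpleGraph.deleteEdges_le _) hreach
    _ ≤ wdist (B u).tree w u (B u).leader + wdist (B u).tree w (B u).leader (P u).leader :=
        wdist_triangle hwT (h.reachable u u (h.mem u)).symm (h.reachable u _ hl)
    _ ≤ R + R := add_le_add (by rw [wdist_comm]; exact h.radius u u (h.mem u)) (h.radius u _ hl)
    _ = 2 * R := (two_mul R).symm

/-- A cluster of `P` is determined by the original cluster and by a node of the set consisting of
the original leader and of the endpoints of the failed edges. -/
lemma IsDegraded.ncard_image_le [Finite V] (hw : ∀ e ∈ G.edgeSet, 1 ≤ w e) (hle : G' ≤ G)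
    (hconn : G'.Connected) (h : IsDegraded G G' w R s I n P) {r : ℝ} (hr : r ≤ s) (u : V) :
    (P '' {x | wdist G' w u x ≤ r}).ncard ≤ I * (2 * n + 1) := by
  classical
  obtain ⟨B, F, h⟩ := h
  let E : Set V := (fun e : Sym2 V => e.out.1) '' F ∪ (fun e : Sym2 V => e.out.2) '' F
  have hE : ∀ e ∈ F, ∀ a ∈ e, a ∈ E := by
    intro e he a ha
    rw [← e.out_eq] at ha
    obtain rfl | rfl := Sym2.mem_iff.1 ha
    · exact .inl ⟨e, he, rfl⟩
    · exact .inr ⟨e, he, rfl⟩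
  have hEcard : E.ncard ≤ 2 * n := by
    have h1 := Set.ncard_image_le (f := fun e : Sym2 V => e.out.1) F.toFinite
    have h2 := Set.ncard_image_le (f := fun e : Sym2 V => e.out.2) F.toFinite
    have h3 := Set.ncard_union_le ((fun e : Sym2 V => e.out.1) '' F) ((fun e => e.out.2) '' F)
    have h4 := h.card_le
    simp only [E]
    omega
  let A : Set (Option V) := insert none (some '' E)
  have hA : A.ncard ≤ 2 * n + 1 :=
    (Set.ncard_insert_le _ _).trans (Nat.succ_le_succ ((Set.ncard_image_le E.toFinite).trans hEcard))
  let p : Cluster V × Option V → V → Prop := fun c x =>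
    B x = c.1 ∧ (c.1.tree.deleteEdges F).Reachable (c.2.getD c.1.leader) x
  let g : Cluster V × Option V → Cluster V := fun c =>
    if hc : ∃ x, p c x then P hc.choose else P u
  have hsub : P '' {x | wdist G' w u x ≤ r} ⊆ g '' ((B '' {x | wdist G w u x ≤ s}) ×ˢ A) := by
    rintro _ ⟨x, hx, rfl⟩
    obtain ⟨a, ha, hax⟩ := exists_reachable_deleteEdges (s := F) (h.reachable x x (h.mem x))
    obtain ⟨o, ho, hoa⟩ : ∃ o ∈ A, o.getD (B x).leader = a := by
      obtain rfl | ⟨e, he, hae⟩ := ha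
      · exact ⟨none, .inl rfl, rfl⟩
      · exact ⟨some a, .inr ⟨a, hE e he a hae, rfl⟩, rfl⟩
    have hex : ∃ y, p (B x, o) y := ⟨x, rfl, by simpa [hoa] using hax⟩
    refine ⟨(B x, o), ⟨⟨x, ?_, rfl⟩, ho⟩, ?_⟩
    · exact ((wdist_anti hw hle (hconn.preconnected u x)).trans hx).trans hr
    · obtain ⟨hy1, hy2⟩ := hex.choose_spec
      simp only [g, dif_pos hex]
      refine h.split.eq_of_mem x _ ((h.split.mem_iff x _).2 ⟨?_, ?_⟩)
      · exact (congrArg Cluster.nodes hy1).subset (h.mem _)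
      · simp only [hoa] at hy2
        exact hax.symm.trans hy2
  calc _ ≤ (g '' ((B '' {x | wdist G w u x ≤ s}) ×ˢ A)).ncard :=
        Set.ncard_le_ncard hsub (((Set.toFinite _).prod A.toFinite).image g)
    _ ≤ ((B '' {x | wdist G w u x ≤ s}) ×ˢ A).ncard :=
        Set.ncard_image_le ((Set.toFinite _).prod A.toFinite)
    _ = (B '' {x | wdist G w u x ≤ s}).ncard * A.ncard := Set.ncard_prod
    _ ≤ I * (2 * n + 1) := Nat.mul_le_mul (h.sparse u) hA

lemma IsSplitOf.refl (hmem : ∀ u, u ∈ (P u).nodes) (heq : ∀ u, ∀ x ∈ (P u).nodes, P x = P u)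
    (hlead : ∀ u, (P u).leader ∈ (P u).nodes)
    (htree : ∀ u, IsShortestPathTree G w (P u).tree (P u).leader)
    (hspan : ∀ u, ∀ x ∈ (P u).nodes, (P u).tree.Reachable (P u).leader x) : IsSplitOf P P ∅ where
  mem_iff u x := by
    simp only [SimpleGraph.deleteEdges_empty, iff_self_and]
    exact fun hx => (hspan u u (hmem u)).symm.trans (hspan u x hx)
  tree_eq u := by
    rw [SimpleGraph.deleteEdges_empty, ← treePart_eq_of_reachable (hspan u u (hmem u))]
    ext x y
    exact ⟨fun h => ⟨h, (htree u).edges_reachable _ _ h⟩, fun h => h.1⟩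
  leader_mem := hlead
  eq_of_mem := heq

lemma IsWeakSparsePartition.isDegraded {r σ : ℝ} (h : IsWeakSparsePartition G w r σ I P)
    (hs : ∀ u, (P '' {x | wdist G w u x ≤ s}).ncard ≤ I) (hR : r * σ ≤ R) :
    IsDegraded G G w R s I n P :=
  ⟨P, ∅, {
    split := .refl h.mem h.eq_of_mem h.leader_mem h.tree_spt h.tree_spans
    card_le := by simp
    mem := h.mem
    tree_le := fun u => (h.tree_spt u).le
    acyclic := fun u => (h.tree_spt u).acyclic
    delete_le := fun u => by simpa using (h.tree_spt u).le
    reachable := h.tree_spans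
    radius := fun u x hx => by
      rw [(h.tree_spt u).dist_eq x (h.tree_spans u x hx)]
      exact (h.weak_diam u _ (h.leader_mem u) x hx).trans hR
    sparse := hs }⟩

lemma IsRootLevel.isDegraded {r : V} (h : IsRootLevel G' w r P) (hle : G' ≤ G) (hI : 1 ≤ I)
    (hR : ∀ x, wdist G' w r x ≤ R) : IsDegraded G G' w R s I n P := by
  obtain ⟨T, hT, hreach, hP⟩ := h
  refine ⟨P, ∅, {
    split := .refl (G := G') (w := w) ?_ ?_ ?_ ?_ ?_
    card_le := by simp
    mem := ?_
    tree_le := ?_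
    acyclic := ?_
    delete_le := ?_
    reachable := ?_
    radius := ?_
    sparse := fun u => ?_ }⟩
  any_goals simp only [hP]
  any_goals simp [hT.acyclic, hT.le, hT.le.trans hle, hreach, hT]
  · exact fun _ x => (hT.dist_eq x (hreach x)).trans_le (hR x)
  · refine le_trans ?_ hI
    rw [← Set.ncard_singleton ({ nodes := Set.univ, leader := r, tree := T } : Cluster V)]
    refine Set.ncard_le_ncard ?_
    rintro _ ⟨x, -, rfl⟩
    exact Set.mem_singleton _

end Degraded

/-! ### Hierarchies after edge failures -/

section Hierarchy

variable {V : Type*} {G G' : SimpleGraph V} {w : Sym2 V → ℝ} {ρ σ κ : ℝ} {I n : ℕ}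

/-- Invariant of the repairs: the levels are degraded weak sparse partitions, and the top level is
a single cluster. The parameters of level `i` are `κ * σ * ρ ^ i` and `ρ ^ i`; at the top
level the radius `s` of the balls is arbitrary, so that its pieces can serve at higher levels once
the hierarchy grows. -/
structure IsDegradedHierarchy (G G' : SimpleGraph V) (w : Sym2 V → ℝ) (ρ σ κ : ℝ) (I n : ℕ)
    (ℋ : Hierarchy V) : Prop where
  level : ∀ i < ℋ.top, IsDegraded G G' w (κ * σ * ρ ^ i) (ρ ^ i) I n (ℋ.cluster i)
  top : ∀ s, IsDegraded G G' w (κ * σ * ρ ^ ℋ.top) s I n (ℋ.cluster ℋ.top)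
  top_eq : ∀ u v, ℋ.cluster ℋ.top u = ℋ.cluster ℋ.top v

lemma IsRootLevel.eq {r : V} {P : V → Cluster V} (h : IsRootLevel G' w r P) (u v : V) :
    P u = P v := by
  obtain ⟨T, -, -, hP⟩ := h
  rw [hP, hP]

lemma IsWeakSparseHierarchy.one_le_sparsity [Finite V] {ℋ : Hierarchy V}
    (h : IsWeakSparseHierarchy G w ρ σ I ℋ) (hw : ∀ e ∈ G.edgeSet, 1 ≤ w e) (hρ : 1 < ρ) (u : V) :
    1 ≤ I := by
  refine le_trans ?_ ((h.level _ le_rfl).sparse u)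
  rw [Nat.one_le_iff_ne_zero, ← Nat.pos_iff_ne_zero, Set.ncard_pos]
  refine ⟨_, u, ?_, rfl⟩
  rw [Set.mem_ofPred_eq, wdist_self hw]
  refine le_min ?_ (by positivity)
  rw [← wdist_self hw u]
  exact wdist_le_wdiam u u

/-- The top level is one cluster of diameter `D`, which forces `σ` to be at least `1`. -/
lemma IsWeakSparseHierarchy.one_le_stretch [Finite V] {ℋ : Hierarchy V}
    (h : IsWeakSparseHierarchy G w ρ σ I ℋ) (hG : G.Connected) (hw : ∀ e ∈ G.edgeSet, 1 ≤ w e)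
    (hρ : 1 < ρ) {a b : V} (hab : a ≠ b) : 1 ≤ σ := by
  have hm : ∀ u v, wdist G w u v ≤ min (wdiam G w) (ρ ^ ℋ.top) * σ := fun u v =>
    (h.level _ le_rfl).weak_diam a u (h.top_nodes a ▸ trivial) v (h.top_nodes a ▸ trivial)
  have h1 : 1 ≤ wdist G w a b := one_le_wdist hw (hG.preconnected a b) hab
  have hD : 0 < wdiam G w := by linarith [wdist_le_wdiam (G := G) (w := w) a b]
  have hmin : 0 < min (wdiam G w) (ρ ^ ℋ.top) := lt_min hD (by positivity)
  have hσ : 0 < σ := by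
    by_contra! hσ
    nlinarith [hm a b]
  have : Nonempty (V × V) := ⟨(a, b)⟩
  have hle : wdiam G w ≤ wdiam G w * σ :=
    ciSup_le fun p => (hm p.1 p.2).trans (mul_le_mul_of_nonneg_right (min_le_left _ _) hσ.le)
  nlinarith

lemma IsWeakSparseHierarchy.isDegradedHierarchy [Finite V] {ℋ : Hierarchy V}
    (h : IsWeakSparseHierarchy G w ρ σ I ℋ) (hI : 1 ≤ I) (hσ : 0 ≤ σ) (hκ : 1 ≤ κ) (hρ : 1 < ρ)
    (hD : 0 < wdiam G w) : IsDegradedHierarchy G G w ρ σ κ I n ℋ := by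
  have hR : ∀ i, min (wdiam G w) (ρ ^ i) * σ ≤ κ * σ * ρ ^ i := fun i => by
    have h1 : min (wdiam G w) (ρ ^ i) * σ ≤ ρ ^ i * σ :=
      mul_le_mul_of_nonneg_right (min_le_right _ _) hσ
    have h2 : 0 ≤ ρ ^ i * σ := by positivity
    nlinarith
  have htop : ∀ u v, ℋ.cluster ℋ.top u = ℋ.cluster ℋ.top v := fun u v =>
    (h.level _ le_rfl).eq_of_mem v u (h.top_nodes v ▸ trivial)
  refine ⟨fun i hi => (h.level i hi.le).isDegraded ?_ (hR i),
    fun s => (h.level _ le_rfl).isDegraded (fun u => le_trans ?_ hI) (hR _), htop⟩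
  · have hlt : ρ ^ i < wdiam G w := by
      rw [h.top_eq, Nat.lt_ceil, Real.lt_logb_iff_rpow_lt hρ hD, Real.rpow_natCast] at hi
      exact hi
    have := (h.level i hi.le).sparse
    rwa [min_eq_right hlt.le] at this
  · rw [← Set.ncard_singleton (ℋ.cluster ℋ.top u)]
    refine Set.ncard_le_ncard ?_
    rintro _ ⟨x, -, rfl⟩
    exact htop x u

lemma IsDegradedHierarchy.repaired {ℋ ℋ' : Hierarchy V} {e : Sym2 V}
    (h : IsDegradedHierarchy G G' w ρ σ κ I n ℋ) (hle : G' ≤ G) (hI : 1 ≤ I) (hσ : 0 ≤ σ)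
    (hκ : 1 ≤ κ) (hρ : 1 < ρ) (h' : Repaired w ρ σ κ (G'.deleteEdges {e}) e ℋ ℋ') :
    IsDegradedHierarchy G (G'.deleteEdges {e}) w ρ σ κ I (n + 1) ℋ' := by
  have hle' := (SimpleGraph.deleteEdges_le (G := G') {e}).trans hle
  cases h' with
  | keep _ htop hdist hlev hroot =>
    rw [← htop] at hlev hroot hdist
    exact ⟨fun i hi => (h.level i (htop ▸ hi)).reclustered (hlev i hi),
      fun s => hroot.isDegraded hle' hI hdist, hroot.eq⟩
  | grow _ hlt hleast hlev hold hcopy hroot =>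
    refine ⟨fun i hi => ?_, fun s => hroot.isDegraded hle' hI fun x => ?_, hroot.eq⟩
    · obtain hi' | rfl | hi' := lt_trichotomy i ℋ.top
      · exact (h.level i hi').reclustered (hlev i hi')
      · exact (h.top _).reclustered hold
      · rw [hcopy i hi' hi]
        refine ((h.top _).reclustered hold).mono ?_
        exact mul_le_mul_of_nonneg_left (pow_le_pow_right₀ hρ.le hi'.le) (by positivity)
    · have h1 := hleast.1 x
      have h2 : 0 ≤ σ * ρ ^ ℋ'.top := by positivity
      nlinarith

lemma AfterFailures.isDegradedHierarchy {ℋ ℋ' : Hierarchy V}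
    (h : AfterFailures w ρ σ κ G ℋ n G' ℋ') (hG : G.Connected)
    (h₀ : IsDegradedHierarchy G G w ρ σ κ I 0 ℋ) (hI : 1 ≤ I) (hσ : 0 ≤ σ)
    (hκ : 1 ≤ κ) (hρ : 1 < ρ) :
    G' ≤ G ∧ G'.Connected ∧ IsDegradedHierarchy G G' w ρ σ κ I n ℋ' := by
  induction h with
  | zero => exact ⟨le_rfl, hG, h₀⟩
  | succ f G' ℋ' ℋ'' e _ _ hconn hrep ih =>
    obtain ⟨hle, -, ih⟩ := ih
    exact ⟨(SimpleGraph.deleteEdges_le _).trans hle, hconn, ih.repaired hle hI hσ hκ hρ hrep⟩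

end Hierarchy

/-! ### Cost of one move -/

namespace Network

variable {V : Type*}

/-- What the cost analysis uses of a network: leaders at level `i` are at distance at most
`L * r_i` from the nodes of their clusters, an `r_i`-neighborhood meets clusters of at most `n`
leaders, and the top level has only one leader. -/
structure IsLocal (N : Network V) (L : ℝ) (n : ℕ) : Prop where
  connected : N.graph.Connected
  one_le_weight : ∀ e ∈ N.graph.edgeSet, 1 ≤ N.weight e
  one_lt_ρ : 1 < N.ρ
  one_le : 1 ≤ L
  dist_lead_le : ∀ i ≤ N.hierarchy.top, ∀ u, N.dist u (N.lead i u) ≤ L * N.r i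
  ncard_contacts_le : ∀ i ≤ N.hierarchy.top, ∀ u, (N.contacts i u).ncard ≤ n
  lead_top : ∀ u v, N.lead N.hierarchy.top u = N.lead N.hierarchy.top v

/-- Length of the link of the directory path between level `i` and the level below. -/
noncomputable def link (N : Network V) (δ : Directory V) (i : ℕ) : ℝ :=
  N.dist (N.path δ i) (levelBelow δ.owner (N.path δ) i)

/-- Potential of the links of the directory path: the amount by which they exceed their regular
length. Links exceed it only in the given initial state, never after they have been renewed by a
move. -/
noncomputable def linkPotential (N : Network V) (L : ℝ) (δ : Directory V) : ℝ :=
  ∑ i ∈ Finset.range (N.hierarchy.top + 1), max 0 (N.link δ i - 3 * L * N.r i)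

/-- Potential of the position of the owner: its distances from the nodes that added the path nodes
below the top level. -/
noncomputable def adderPotential (N : Network V) (δ : Directory V) : ℝ :=
  ∑ i ∈ Finset.range N.hierarchy.top, N.dist δ.owner (δ.adder i)

lemma dist_comm (N : Network V) (u v : V) : N.dist u v = N.dist v u := wdist_comm u v

lemma dist_le_diam [Finite V] (N : Network V) (u v : V) : N.dist u v ≤ N.diam :=
  wdist_le_wdiam u v

/-- A move that does not discover the path at level `i` is issued far away from the node that added
the path node at this level. -/
lemma r_lt_dist_adder {N : Network V} {δ : Directory V} {u : V} {i : ℕ}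
    (hi : i < N.meet δ u) : N.r i < N.dist u (δ.adder i) := by
  by_contra! h
  exact Nat.notMem_of_lt_sInf hi ⟨δ.adder i, h, rfl⟩

lemma optCost_cons_cons (N : Network V) (u v : V) (S : List V) :
    N.optCost (u :: v :: S) = N.dist u v + N.optCost (v :: S) := by
  simp [optCost]

namespace IsLocal

variable {N : Network V} {L m : ℝ} {n : ℕ} {δ : Directory V} {u : V} {i : ℕ}

lemma dist_nonneg (hN : N.IsLocal L n) (u v : V) : 0 ≤ N.dist u v :=
  wdist_nonneg hN.one_le_weight u v

lemma dist_self (hN : N.IsLocal L n) (u : V) : N.dist u u = 0 := wdist_self hN.one_le_weight u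

lemma dist_triangle (hN : N.IsLocal L n) (u v x : V) : N.dist u x ≤ N.dist u v + N.dist v x :=
  wdist_triangle hN.one_le_weight (hN.connected.preconnected u v) (hN.connected.preconnected v x)

lemma one_le_dist (hN : N.IsLocal L n) {u v : V} (h : u ≠ v) : 1 ≤ N.dist u v :=
  one_le_wdist hN.one_le_weight (hN.connected.preconnected u v) h

lemma diam_nonneg [Finite V] (hN : N.IsLocal L n) : 0 ≤ N.diam := by
  obtain ⟨u⟩ := hN.connected.nonempty
  exact (hN.dist_nonneg u u).trans (N.dist_le_diam u u)

lemma r_nonneg [Finite V] (hN : N.IsLocal L n) (i : ℕ) : 0 ≤ N.r i :=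
  le_min hN.diam_nonneg (pow_nonneg (zero_le_one.trans hN.one_lt_ρ.le) i)

lemma r_mono (hN : N.IsLocal L n) : Monotone N.r := fun _ _ h =>
  min_le_min_left _ (pow_le_pow_right₀ hN.one_lt_ρ.le h)

lemma r_add_le [Finite V] (hN : N.IsLocal L n) (i k : ℕ) : N.r (i + k) ≤ N.ρ ^ k * N.r i := by
  have hρ : 1 ≤ N.ρ ^ k := one_le_pow₀ hN.one_lt_ρ.le
  simp only [r]
  rw [mul_min_of_nonneg _ _ (by linarith), pow_add, mul_comm (N.ρ ^ i)]
  exact min_le_min_right _ (le_mul_of_one_le_left hN.diam_nonneg hρ)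

lemma dist_le_of_mem_contacts [Finite V] (hN : N.IsLocal L n) {l : V}
    (hi : i ≤ N.hierarchy.top) (hl : l ∈ N.contacts i u) : N.dist u l ≤ 2 * L * N.r i := by
  obtain ⟨x, hx, rfl⟩ := hl
  rw [Set.mem_ofPred_eq] at hx
  nlinarith [hN.dist_triangle u x (N.lead i x), hN.dist_lead_le i hi x, hN.one_le, hN.r_nonneg i]

lemma dist_specialParent_le [Finite V] (hN : N.IsLocal L n) (hm : N.ρ ^ N.k ≤ m)
    (hi : i ≤ N.hierarchy.top) (v : V) :
    N.dist (N.lead i v) (N.specialParent i v) ≤ L * (1 + m) * N.r i := by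
  have h1 := hN.dist_triangle (N.lead i v) v (N.specialParent i v)
  rw [N.dist_comm (N.lead i v) v] at h1
  have h2 := hN.dist_lead_le i hi v
  have h3 : N.dist v (N.specialParent i v) ≤ _ :=
    hN.dist_lead_le (min (i + N.k) N.hierarchy.top) (min_le_right _ _) v
  have h4 : N.r (min (i + N.k) N.hierarchy.top) ≤ m * N.r i :=
    (hN.r_mono (min_le_left _ _)).trans ((hN.r_add_le i N.k).trans
      (mul_le_mul_of_nonneg_right hm (hN.r_nonneg i)))
  nlinarith [mul_le_mul_of_nonneg_left h4 (zero_le_one.trans hN.one_le)]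

/-- The root is a contact of every node at the top level, so a move discovers the path there at the
latest. -/
lemma path_top_mem_contacts [Finite V] (hN : N.IsLocal L n) (δ : Directory V) (u : V) :
    N.path δ N.hierarchy.top ∈ N.contacts N.hierarchy.top u :=
  ⟨u, (hN.dist_self u).trans_le (hN.r_nonneg _), hN.lead_top _ _⟩

lemma meet_le_top [Finite V] (hN : N.IsLocal L n) (δ : Directory V) (u : V) :
    N.meet δ u ≤ N.hierarchy.top :=
  Nat.sInf_le (hN.path_top_mem_contacts δ u)

lemma path_meet_mem_contacts [Finite V] (hN : N.IsLocal L n) (δ : Directory V) (u : V) :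
    N.path δ (N.meet δ u) ∈ N.contacts (N.meet δ u) u :=
  Nat.sInf_mem (s := {i | N.path δ i ∈ N.contacts i u}) ⟨_, hN.path_top_mem_contacts δ u⟩

lemma dist_levelBelow_le [Finite V] (hN : N.IsLocal L n) (hi : i ≤ N.hierarchy.top) (u : V) :
    N.dist u (levelBelow u (fun m => N.lead m u) i) ≤ L * N.r i := by
  have hL := zero_le_one.trans hN.one_le
  cases i with
  | zero => exact (hN.dist_self u).trans_le (mul_nonneg hL (hN.r_nonneg 0))
  | succ i =>
    exact (hN.dist_lead_le i (by omega) u).trans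
      (mul_le_mul_of_nonneg_left (hN.r_mono i.le_succ) hL)

lemma sum_contacts_le [Fintype V] [DecidablePred fun l => l ∈ N.contacts i u]
    (hN : N.IsLocal L n) (hi : i ≤ N.hierarchy.top) :
    ∑ l ∈ Finset.univ.filter (fun l => l ∈ N.contacts i u), 2 * N.dist u l
      ≤ 4 * n * L * N.r i := by
  have hcard : (Finset.univ.filter (fun l => l ∈ N.contacts i u)).card ≤ n := by
    rw [← Set.ncard_coe_finset]
    simpa using hN.ncard_contacts_le i hi u
  have hr : 0 ≤ 4 * L * N.r i :=
    mul_nonneg (mul_nonneg (by norm_num) (zero_le_one.trans hN.one_le)) (hN.r_nonneg i)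
  calc _ ≤ (Finset.univ.filter (fun l => l ∈ N.contacts i u)).card • (4 * L * N.r i) :=
        Finset.sum_le_card_nsmul _ _ _ fun l hl => by
          linarith [hN.dist_le_of_mem_contacts hi (Finset.mem_filter.1 hl).2]
    _ ≤ n * (4 * L * N.r i) := by
        rw [nsmul_eq_mul]
        exact mul_le_mul_of_nonneg_right (Nat.cast_le.2 hcard) hr
    _ = 4 * n * L * N.r i := by ring

lemma upCost_le [Fintype V] (hN : N.IsLocal L n) (hm : N.ρ ^ N.k ≤ m) (δ : Directory V) (u : V) :
    N.upCost δ u ≤ L * (4 * n + 12 + m) * ∑ i ∈ Finset.range (N.meet δ u + 1), N.r i := by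
  classical
  have htop := hN.meet_le_top δ u
  have hL := zero_le_one.trans hN.one_le
  have hm0 : 0 ≤ m := (pow_nonneg (zero_le_one.trans hN.one_lt_ρ.le) _).trans hm
  have h3 : 2 * N.dist (N.path δ (N.meet δ u))
      (levelBelow u (fun m => N.lead m u) (N.meet δ u)) ≤ 6 * L * N.r (N.meet δ u) := by
    have h1 := hN.dist_le_of_mem_contacts htop (hN.path_meet_mem_contacts δ u)
    have h2 := hN.dist_levelBelow_le htop u
    have h3 := hN.dist_triangle (N.path δ (N.meet δ u)) u
      (levelBelow u (fun m => N.lead m u) (N.meet δ u))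
    rw [N.dist_comm _ u] at h3
    linarith
  have h2 : ∀ i ∈ Finset.range (N.meet δ u), N.dist u (N.lead i u)
        + 2 * N.dist (N.lead i u) (levelBelow u (fun m => N.lead m u) i)
        + N.dist (N.lead i u) (N.specialParent i u) ≤ L * (6 + m) * N.r i := by
    intro i hi
    have hi' : i ≤ N.hierarchy.top := (Finset.mem_range.1 hi).le.trans htop
    have h1 := hN.dist_lead_le i hi' u
    have h2 := hN.dist_levelBelow_le hi' u
    have h3 := hN.dist_triangle (N.lead i u) u (levelBelow u (fun m => N.lead m u) i)
    rw [N.dist_comm _ u] at h3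
    linarith [hN.dist_specialParent_le hm hi' u]
  have h1 : ∀ i ∈ Finset.range (N.meet δ u + 1), _ := fun i hi =>
    hN.sum_contacts_le (u := u) ((Nat.lt_succ_iff.1 (Finset.mem_range.1 hi)).trans htop)
  unfold upCost
  refine (add_le_add (add_le_add (Finset.sum_le_sum h1) (Finset.sum_le_sum h2)) h3).trans ?_
  rw [← Finset.mul_sum, ← Finset.mul_sum, Finset.sum_range_succ]
  have hS : 0 ≤ ∑ i ∈ Finset.range (N.meet δ u), N.r i :=
    Finset.sum_nonneg fun i _ => hN.r_nonneg i
  have hr := hN.r_nonneg (N.meet δ u)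
  nlinarith [mul_nonneg hL hS, mul_nonneg hL hr, mul_nonneg hm0 (mul_nonneg hL hr)]

/-- Up to the level at which the path is discovered, links are renewed by a move and get their
regular length; the other links stay. -/
lemma sum_link_add_linkPotential_le [Finite V] (hN : N.IsLocal L n) (δ : Directory V) (u : V) :
    ∑ i ∈ Finset.range (N.meet δ u + 1), N.link δ i + N.linkPotential L (N.move δ u) ≤
      3 * L * ∑ i ∈ Finset.range (N.meet δ u + 1), N.r i + N.linkPotential L δ := by
  set j := N.meet δ u with hj
  have htop : j ≤ N.hierarchy.top := hN.meet_le_top δ u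
  have hlt : ∀ i < j, N.path (N.move δ u) i = N.lead i u := fun i hi => by
    simp [path, move, ← hj, hi]
  have hge : ∀ i, j ≤ i → N.path (N.move δ u) i = N.path δ i := fun i hi => by
    simp [path, move, ← hj, hi.not_gt]
  have hnew : ∀ i ≤ j, N.link (N.move δ u) i ≤ 3 * L * N.r i := by
    intro i hi
    have hbelow : levelBelow (N.move δ u).owner (N.path (N.move δ u)) i =
        levelBelow u (fun m => N.lead m u) i := by
      cases i with
      | zero => rfl
      | succ i => exact hlt i hi
    have h1 : N.dist u (N.path (N.move δ u) i) ≤ 2 * L * N.r i := by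
      obtain hi' | rfl := hi.lt_or_eq
      · rw [hlt i hi']
        have h2 := hN.dist_lead_le i (hi.trans htop) u
        have h3 := mul_nonneg (zero_le_one.trans hN.one_le) (hN.r_nonneg i)
        linarith
      · rw [hge _ le_rfl]
        exact hN.dist_le_of_mem_contacts htop (hN.path_meet_mem_contacts δ u)
    have h2 := hN.dist_levelBelow_le (hi.trans htop) u
    have h3 := hN.dist_triangle (N.path (N.move δ u) i) u
      (levelBelow u (fun m => N.lead m u) i)
    rw [N.dist_comm _ u] at h3
    rw [link, hbelow]
    linarith
  have hold : ∀ i, j < i → N.link (N.move δ u) i = N.link δ i := by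
    intro i hi
    obtain ⟨i, rfl⟩ : ∃ i', i = i' + 1 := ⟨i - 1, by omega⟩
    rw [link, link, hge _ hi.le, levelBelow, levelBelow, hge i (by omega)]
  have hsplit := fun g : ℕ → ℝ => Finset.sum_range_add_sum_Ico g (Nat.succ_le_succ htop)
  rw [linkPotential, linkPotential, ← hsplit, ← hsplit, Finset.mul_sum, ← add_assoc, ← add_assoc,
    ← Finset.sum_add_distrib, ← Finset.sum_add_distrib]
  refine add_le_add (Finset.sum_le_sum fun i hi => ?_) (Finset.sum_le_sum fun i hi => ?_)
  · rw [max_eq_left (by linarith [hnew i (Nat.lt_succ_iff.1 (Finset.mem_range.1 hi))])]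
    linarith [le_max_right 0 (N.link δ i - 3 * L * N.r i)]
  · rw [hold i (Finset.mem_Ico.1 hi).1]

lemma downCost_add_linkPotential_le [Finite V] (hN : N.IsLocal L n) (hm : N.ρ ^ N.k ≤ m)
    (δ : Directory V) (u : V) :
    N.downCost δ u + N.linkPotential L (N.move δ u) ≤
      L * (4 + m) * (∑ i ∈ Finset.range (N.meet δ u + 1), N.r i) + N.linkPotential L δ +
        N.dist δ.owner u := by
  have h1 := hN.sum_link_add_linkPotential_le δ u
  have h2 : ∑ i ∈ Finset.range (N.meet δ u), N.dist (N.path δ i) (N.specialParent i (δ.adder i)) ≤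
      L * (1 + m) * ∑ i ∈ Finset.range (N.meet δ u), N.r i := by
    rw [Finset.mul_sum]
    exact Finset.sum_le_sum fun i hi => hN.dist_specialParent_le hm
      ((Finset.mem_range.1 hi).le.trans (hN.meet_le_top δ u)) _
  have hm0 : 0 ≤ m := (pow_nonneg (zero_le_one.trans hN.one_lt_ρ.le) _).trans hm
  have h3 : 0 ≤ L * (1 + m) * N.r (N.meet δ u) :=
    mul_nonneg (mul_nonneg (zero_le_one.trans hN.one_le) (by linarith)) (hN.r_nonneg _)
  simp only [link] at h1
  unfold downCost
  rw [Finset.sum_range_succ N.r] at h1 ⊢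
  linarith

/-- The amortized form of `Network.r_lt_dist_adder`: a move that does not discover the path at
level `i` makes the distance of the owner from the adder of that level drop to `0`. -/
lemma sum_r_add_adderPotential_le (hN : N.IsLocal L n) [Finite V] (δ : Directory V) (u : V) :
    ∑ i ∈ Finset.range (N.meet δ u), N.r i + N.adderPotential (N.move δ u) ≤
      N.adderPotential δ + N.hierarchy.top * N.dist δ.owner u := by
  have hsplit := fun g : ℕ → ℝ => Finset.sum_range_add_sum_Ico g (hN.meet_le_top δ u)
  have hconst : (N.hierarchy.top : ℝ) * N.dist δ.owner u =
      ∑ i ∈ Finset.range N.hierarchy.top, N.dist δ.owner u := by simp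
  rw [adderPotential, adderPotential, hconst, ← Finset.sum_add_distrib, ← hsplit, ← hsplit,
    ← add_assoc, ← Finset.sum_add_distrib]
  have htri := fun i => hN.dist_triangle u δ.owner (δ.adder i)
  simp only [N.dist_comm u δ.owner] at htri
  refine add_le_add (Finset.sum_le_sum fun i hi => ?_) (Finset.sum_le_sum fun i hi => ?_)
  · have hi' := Finset.mem_range.1 hi
    simp only [move, hi', if_true, hN.dist_self]
    linarith [r_lt_dist_adder hi', htri i]
  · simp only [move, (Finset.mem_Ico.1 hi).1.not_gt, if_false]
    linarith [htri i]

lemma sum_r_succ_le [Finite V] (hN : N.IsLocal L n) (j : ℕ) :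
    ∑ i ∈ Finset.range (j + 1), N.r i ≤ 1 + N.ρ * ∑ i ∈ Finset.range j, N.r i := by
  rw [Finset.sum_range_succ', add_comm, Finset.mul_sum]
  refine add_le_add ((min_le_right _ _).trans_eq (pow_zero _)) (Finset.sum_le_sum fun i _ => ?_)
  simpa using hN.r_add_le i 1

/-! ### Cost of a sequence of moves -/

lemma length_le_optCost (hN : N.IsLocal L n) :
    ∀ S : List V, S.IsChain (· ≠ ·) → (S.length : ℝ) ≤ N.optCost S + 1
  | [], _ => by simp [optCost]
  | [u], _ => by simp [optCost]
  | u :: v :: S, h => by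
    rw [List.isChain_cons_cons] at h
    have ih := hN.length_le_optCost (v :: S) h.2
    rw [optCost_cons_cons]
    simp only [List.length_cons, Nat.cast_add, Nat.cast_one] at ih ⊢
    linarith [hN.one_le_dist h.1]

/-- Summation of the amortized costs of the moves; the moves start at the initial owner, whence the
list `δ.owner :: S` on the right-hand side. -/
lemma totalCost_le_potential [Fintype V] (hN : N.IsLocal L n) (hm : N.ρ ^ N.k ≤ m) (S : List V) :
    ∀ δ : Directory V, N.totalCost δ S ≤
      L * (4 * n + 16 + 2 * m) *
        (S.length + N.ρ * (N.hierarchy.top * N.optCost (δ.owner :: S) + N.adderPotential δ)) +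
      N.linkPotential L δ + N.optCost (δ.owner :: S) := by
  have hL := zero_le_one.trans hN.one_le
  have hρ := zero_le_one.trans hN.one_lt_ρ.le
  have hm0 : 0 ≤ m := (pow_nonneg hρ _).trans hm
  set E := L * (4 * n + 16 + 2 * m) with hE
  have hE0 : 0 ≤ E := by positivity
  induction S with
  | nil =>
    intro δ
    have h1 : 0 ≤ N.adderPotential δ := Finset.sum_nonneg fun i _ => hN.dist_nonneg _ _
    have h2 : 0 ≤ N.linkPotential L δ := Finset.sum_nonneg fun i _ => le_max_left _ _
    have h3 : 0 ≤ E * (N.ρ * N.adderPotential δ) := by positivity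
    simp only [totalCost, optCost, List.tail_cons, List.zipWith_nil_right, List.sum_nil,
      List.length_nil, Nat.cast_zero]
    linarith
  | cons u S ih =>
    intro δ
    have ih := ih (N.move δ u)
    have h1 := hN.upCost_le hm δ u
    have h2 := hN.downCost_add_linkPotential_le hm δ u
    have h3 := mul_le_mul_of_nonneg_left (hN.sum_r_succ_le (N.meet δ u)) hE0
    have h4 := mul_le_mul_of_nonneg_left
      (mul_le_mul_of_nonneg_left (hN.sum_r_add_adderPotential_le δ u) hρ) hE0
    have ho : (N.move δ u).owner = u := rfl
    rw [ho] at ih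
    rw [optCost_cons_cons]
    simp only [totalCost, List.length_cons, Nat.cast_add, Nat.cast_one]
    rw [hE] at h3 h4 ih ⊢
    linarith

/-- The initial potentials are at most proportional to the diameter, and a sequence with more than
`D` moves has at least a proportional optimal cost. -/
lemma totalCost_le [Fintype V] (hN : N.IsLocal L n) (hm : N.ρ ^ N.k ≤ m) (δ : Directory V)
    {S : List V} (hS : S.IsChain (· ≠ ·)) (hlen : 1 < S.length) (hD : N.diam ≤ S.length) :
    N.totalCost δ S ≤ 14 * (max N.hierarchy.top 1 : ℕ) * N.ρ * (L * (4 * n + 16 + 2 * m)) *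
      N.optCost S := by
  have hL := hN.one_le
  have hρ := hN.one_lt_ρ.le
  have hm1 : 1 ≤ m := (one_le_pow₀ hρ).trans hm
  have hD0 := hN.diam_nonneg
  have hq := hN.length_le_optCost S hS
  have hq2 : (2 : ℝ) ≤ S.length := by exact_mod_cast hlen
  set opt := N.optCost S with hopt
  have hqo : (S.length : ℝ) ≤ 2 * opt := by linarith
  have hopt' : N.optCost (δ.owner :: S) ≤ 3 * opt := by
    obtain - | ⟨v, S⟩ := S
    · simp at hlen
    · rw [optCost_cons_cons]
      linarith [N.dist_le_diam δ.owner v]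
  have hadder : N.adderPotential δ ≤ N.hierarchy.top * (2 * opt) := by
    refine (Finset.sum_le_card_nsmul _ _ (2 * opt) fun i _ => ?_).trans_eq (by simp)
    linarith [N.dist_le_diam δ.owner (δ.adder i)]
  have hlink : N.linkPotential L δ ≤ (N.hierarchy.top + 1) * (2 * opt) := by
    refine (Finset.sum_le_card_nsmul _ _ (2 * opt) fun i _ => ?_).trans_eq (by simp)
    refine max_le (by linarith) ?_
    have h1 : N.link δ i ≤ N.diam := N.dist_le_diam _ _
    have h2 : 0 ≤ 3 * L * N.r i := mul_nonneg (by linarith) (hN.r_nonneg i)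
    linarith
  have htot := hN.totalCost_le_potential hm S δ
  set E := L * (4 * n + 16 + 2 * m) with hE
  set M : ℝ := ((max N.hierarchy.top 1 : ℕ) : ℝ) with hM
  have hM1 : 1 ≤ M := by simp [hM]
  have htM : (N.hierarchy.top : ℝ) ≤ M := by simp [hM]
  have hE1 : 1 ≤ E := by
    have : (1 : ℝ) ≤ 4 * n + 16 + 2 * m := by linarith [Nat.cast_nonneg (α := ℝ) n]
    exact one_le_mul_of_one_le_of_one_le hL this
  have hMo : (N.hierarchy.top : ℝ) * opt ≤ M * opt :=
    mul_le_mul_of_nonneg_right htM (by linarith)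
  have h1 : opt ≤ M * opt := le_mul_of_one_le_left (by linarith) hM1
  have h2 : M * opt ≤ N.ρ * (M * opt) := le_mul_of_one_le_left (by linarith) hρ
  have h3 : N.ρ * (M * opt) ≤ E * (N.ρ * (M * opt)) := le_mul_of_one_le_left (by linarith) hE1
  have h4 : (N.hierarchy.top : ℝ) * N.optCost (δ.owner :: S) + N.adderPotential δ ≤
      5 * (M * opt) := by
    have := mul_le_mul_of_nonneg_left hopt' (Nat.cast_nonneg (α := ℝ) N.hierarchy.top)
    linarith
  have h5 := mul_le_mul_of_nonneg_left h4 (zero_le_one.trans hρ)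
  have h6 := mul_le_mul_of_nonneg_left (add_le_add hqo h5) (zero_le_one.trans hE1)
  have h7 : E * (2 * opt) ≤ 2 * (E * (N.ρ * (M * opt))) := by
    have := mul_le_mul_of_nonneg_left (h1.trans h2) (zero_le_one.trans hE1)
    linarith
  have : 14 * M * N.ρ * E * opt = 14 * (E * (N.ρ * (M * opt))) := by ring
  linarith

end IsLocal

end Network

/-! ### The competitive ratio -/

theorem mainTheorem4 (c' κ : ℝ) (hκ : 1 ≤ κ) :
    ∃ C : ℝ, 0 < C ∧
      ∀ (V : Type*) [Fintype V] (G : SimpleGraph V) (w : Sym2 V → ℝ)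
        (ρ σ : ℝ) (I : ℕ) (ℋ : Hierarchy V) (k : ℕ)
        (f : ℕ) (G' : SimpleGraph V) (ℋ' : Hierarchy V),
        G.Connected → (∀ e ∈ G.edgeSet, 1 ≤ w e) →
        1 < ρ → IsWeakSparseHierarchy G w ρ σ I ℋ → ρ ^ k ≤ c' * σ →
        1 ≤ f → AfterFailures w ρ σ κ G ℋ f G' ℋ' →
        ∀ (N : Network V),
          N = { graph := G', weight := w, hierarchy := ℋ', ρ := ρ, k := k } →
          ∀ (δ : Directory V) (S : List V),
            S.IsChain (· ≠ ·) →
            ((max ℋ'.top 1 : ℕ) : ℝ) ^ 2 * N.diam < S.length →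
            N.totalCost δ S ≤
              C * ((max ℋ'.top 1 : ℕ) : ℝ) * σ * ρ * (f * I + σ) * N.optCost S := by
  refine ⟨28 * κ * (16 + 2 * |c'|), by positivity, ?_⟩
  intro V _ G w ρ σ I ℋ k f G' ℋ' hG hw hρ hℋ hk hf hfail N hNeq δ S hS hlen
  -- An edge fails, so there are two different nodes, `σ` is at least `1`, and diameters are positive.
  obtain ⟨a, b, hab⟩ : ∃ a b : V, a ≠ b := by
    cases hfail with
    | zero => omega
    | succ f G' ℋ' ℋ'' e _ he _ _ =>
      induction e with
      | h x y => exact ⟨x, y, (SimpleGraph.mem_edgeSet _ |>.1 he).ne⟩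
  have hσ : 1 ≤ σ := hℋ.one_le_stretch hG hw hρ hab
  have hI : 1 ≤ I := hℋ.one_le_sparsity hw hρ a
  have hD : 0 < wdiam G w := zero_lt_one.trans_le
    ((one_le_wdist hw (hG.preconnected a b) hab).trans (wdist_le_wdiam a b))
  obtain ⟨hle, hconn, hdeg⟩ := hfail.isDegradedHierarchy hG
    (hℋ.isDegradedHierarchy hI (by linarith) hκ hρ hD) hI (by linarith) hκ hρ
  have hw' : ∀ e ∈ G'.edgeSet, 1 ≤ w e := fun e he =>
    hw e (SimpleGraph.edgeSet_subset_edgeSet.2 hle he)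
  have hκσ : 1 ≤ κ * σ := one_le_mul_of_one_le_of_one_le hκ hσ
  have hlevel : ∀ i ≤ ℋ'.top,
      IsDegraded G G' w (κ * σ * ρ ^ i) (ρ ^ i) I f (ℋ'.cluster i) := fun i hi =>
    hi.lt_or_eq.elim (hdeg.level i) fun h => h ▸ hdeg.top _
  have hN : N.IsLocal (2 * (κ * σ)) (I * (2 * f + 1)) := by
    subst hNeq
    refine ⟨hconn, hw', hρ, by linarith, fun i hi u => ?_, fun i hi u => ?_, fun u v => ?_⟩
    · simp only [Network.r]
      rw [mul_min_of_nonneg _ _ (by linarith)]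
      refine le_min ?_ ?_
      · -- `2 * κ * σ` is at least `1`, so the bound by the diameter is trivial.
        refine (Network.dist_le_diam _ _ _).trans (le_mul_of_one_le_left ?_ (by linarith))
        exact (wdist_nonneg hw' a a).trans (wdist_le_wdiam a a)
      · exact ((hlevel i hi).wdist_leader_le hw hle u).trans_eq (by ring)
    · have h1 := (hlevel i hi).ncard_image_le hw hle hconn
        (min_le_right (wdiam G' w) (ρ ^ i)) u
      refine le_trans ?_ h1
      have h2 := Set.ncard_image_le (f := Cluster.leader)
        (Set.toFinite (ℋ'.cluster i '' {x | wdist G' w u x ≤ min (wdiam G' w) (ρ ^ i)}))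
      rwa [Set.image_image] at h2
    · exact congrArg Cluster.leader (hdeg.top_eq u v)
  have hdiam : 1 ≤ N.diam := (hN.one_le_dist hab).trans (N.dist_le_diam a b)
  have hlen' : N.diam < S.length := by
    refine lt_of_le_of_lt (le_mul_of_one_le_left (by linarith) (one_le_pow₀ ?_)) hlen
    simp
  have hlen1 : 1 < S.length := by exact_mod_cast hdiam.trans_lt hlen'
  have hm : N.ρ ^ N.k ≤ c' * σ := by rw [hNeq]; exact hk
  have hcost := hN.totalCost_le hm δ hS hlen1 hlen'.le
  have hNρ : N.ρ = ρ := by rw [hNeq]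
  have hNtop : N.hierarchy.top = ℋ'.top := by rw [hNeq]
  rw [hNρ, hNtop] at hcost
  refine hcost.trans ?_
  have hopt : 0 ≤ N.optCost S := by
    have h1 := hN.length_le_optCost S hS
    have h2 : (1 : ℝ) < S.length := by exact_mod_cast hlen1
    linarith
  set M : ℝ := ((max ℋ'.top 1 : ℕ) : ℝ) with hM
  -- `2 * f + 1 ≤ 3 * f` and `1 ≤ σ`.
  have hbracket : 4 * ((I * (2 * f + 1) : ℕ) : ℝ) + 16 + 2 * (c' * σ) ≤
      (16 + 2 * |c'|) * (f * I + σ) := by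
    have hf' : (1 : ℝ) ≤ f := by exact_mod_cast hf
    have h1 : (I : ℝ) ≤ f * I := le_mul_of_one_le_left (Nat.cast_nonneg I) hf'
    have h2 : c' * σ ≤ |c'| * σ := mul_le_mul_of_nonneg_right (le_abs_self c') (by linarith)
    have h3 : 0 ≤ |c'| * (f * I) := by positivity
    push_cast
    linarith
  have hρ0 : 0 ≤ ρ := by linarith
  have h0 : 0 ≤ 14 * M * ρ * (2 * (κ * σ)) * N.optCost S := by positivity
  calc _ = 14 * M * ρ * (2 * (κ * σ)) * N.optCost S *
        (4 * ((I * (2 * f + 1) : ℕ) : ℝ) + 16 + 2 * (c' * σ)) := by ring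
    _ ≤ 14 * M * ρ * (2 * (κ * σ)) * N.optCost S * ((16 + 2 * |c'|) * (f * I + σ)) :=
        mul_le_mul_of_nonneg_left hbracket h0
    _ = _ := by ring
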